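/- Let $d,n\in\mathbb{N}\cup\{0\}$, $\tau\in(0,\infty)$, $T=(n+1)\tau$, $x_0\in\mathbb{R}^d$, let $\|\cdot\|$ be the Euclidean norm, and let $f:[0,T]\times\mathbb{R}^d\times\mathbb{R}^d\to\mathbb{R}^d$ satisfy: $f(t,\cdot,\cdot)$ is continuous for every $t\in[0,T]$; $f(\cdot,x,z)$ is Borel measurable for all $x,z\in\mathbb{R}^d$; and there are $\bar K,L:[0,T]\to[0,\infty)$ in $L^\infty([0,T])$ such that $\|f(t,0,0)\|\le \bar K(t)$ and $\|f(t,x_1,z_1)-f(t,x_2,z_2)\|\le L(t)\bigl(\|x_1-x_2\|+\|z_1-z_2\|\bigr)$ for all $t\in[0,T]$ and $x_1,x_2,z_1,z_2\in\mathbb{R}^d$. Let $\{\gamma_k^j\}_{j\ge 0,\,k\ge 1}$ be i.i.d. random variables on a probability space $(\Omega,\Sigma,\mathbb{P})$, uniformly distributed on $[0,1]$. For $N\in\mathbb{N}$, $N\ge1$, put $h=\tau/N$, $t_k^j=j\tau+kh$, $y_k^{-1}=x_0$ for $0\le k\le N$, and, for $j=0,\dots,n$ and $k=0,\dots,N-1$,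 \[ y_0^j=y_N^{j-1},\qquad y_{k+1}^j=y_k^j+h\,f\bigl(t_k^j+h\gamma_{k+1}^j,\;y_k^j,\;y_k^{j-1}\bigr). \] Then the delay differential equation $x'(t)=f(t,x(t),x(t-\tau))$ for almost every $t\in[0,T]$, $x(t)=x_0$ for $t\in[-\tau,0]$, has an absolutely continuous solution $x$ on $[-\tau,T]$, and for every such solution $x$ and every $\varepsilon\in(0,1/2)$ there is a real random variable $\eta$, not depending on $N$, with $\eta\in L^q(\Omega)$ for all $q\in[2,\infty)$, such that, almost surely, for all integers $N\ge\lceil\tau\rceil$, \[ \max_{0\le j\le n}\;\max_{0\le i\le N}\|x(t_i^j)-y_i^j\|\le \eta\,N^{-1/2+\varepsilon}. \] -/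

import Mathlib

open MeasureTheory ProbabilityTheory Set
open scoped ENNReal

noncomputable section

/-- `ℝ^d` with the Euclidean norm. -/
abbrev Vec (d : ℕ) : Type := EuclideanSpace ℝ (Fin d)

/-- Regularity of the right-hand side `f = f(t, x, z)` on `[0, T]`: `f(t, ·, ·)` is continuous for
every `t`, `f(·, x, z)` is Borel measurable for all `(x, z)`, and for some `K, L ≥ 0` in
`L^p([0, T])` one has `‖f(t, 0, 0)‖ ≤ K(t)` and
`‖f(t, x₁, z₁) - f(t, x₂, z₂)‖ ≤ L(t) (‖x₁ - x₂‖ + ‖z₁ - z₂‖ ^ α)`.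
Only the values of `f`, `K`, `L` for `t ∈ [0, T]` matter. -/
structure IsAdmissibleRHS {d : ℕ} (T : ℝ) (p : ℝ≥0∞) (α : ℝ)
    (f : ℝ → Vec d → Vec d → Vec d) : Prop where
  continuous_space : ∀ t ∈ Icc 0 T, Continuous fun w : Vec d × Vec d => f t w.1 w.2
  measurable_time : ∀ x z : Vec d, Measurable fun t : Icc (0 : ℝ) T => f t x z
  bounds : ∃ K L : ℝ → ℝ,
    (∀ t ∈ Icc 0 T, 0 ≤ K t) ∧ (∀ t ∈ Icc 0 T, 0 ≤ L t) ∧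
    MemLp K p (volume.restrict (Icc 0 T)) ∧ MemLp L p (volume.restrict (Icc 0 T)) ∧
    (∀ t ∈ Icc 0 T, ‖f t 0 0‖ ≤ K t) ∧
    (∀ t ∈ Icc 0 T, ∀ x₁ x₂ z₁ z₂ : Vec d,
      ‖f t x₁ z₁ - f t x₂ z₂‖ ≤ L t * (‖x₁ - x₂‖ + ‖z₁ - z₂‖ ^ α))

/-- `x` is an absolutely continuous (Carathéodory) solution on `[-τ, T]` of
`x'(t) = f(t, x(t), x(t - τ))` for `t ∈ [0, T]`, with `x = x₀` on the initial interval
`[-τ, 0]`. Only the values of `x` on `[-τ, T]` matter. -/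
structure IsDelaySolution {d : ℕ} (τ T : ℝ) (x₀ : Vec d)
    (f : ℝ → Vec d → Vec d → Vec d) (x : ℝ → Vec d) : Prop where
  initial : ∀ t ∈ Icc (-τ) 0, x t = x₀
  absolutelyContinuous : AbsolutelyContinuousOnInterval x 0 T
  hasDerivAt : ∀ᵐ t ∂(volume.restrict (Icc 0 T)), HasDerivAt x (f t (x t) (x (t - τ))) t

/-- The grid point `t_k^j = j τ + k h` with `h = τ / N`. -/
def gridPoint (τ : ℝ) (N j k : ℕ) : ℝ := j * τ + k * (τ / N)

/-- One delay interval (the `j`-th) of the randomized Euler scheme, computed from the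
approximations `prev 0, …, prev N` on the preceding interval:
`y_0 = prev N` and `y_{k+1} = y_k + h f(t_k^j + h g_k, y_k, prev k)`. -/
def eulerRow {d : ℕ} (f : ℝ → Vec d → Vec d → Vec d) (τ : ℝ) (N j : ℕ) (g : ℕ → ℝ)
    (prev : ℕ → Vec d) : ℕ → Vec d
  | 0 => prev N
  | k + 1 => eulerRow f τ N j g prev k +
      (τ / N) • f (gridPoint τ N j k + (τ / N) * g k) (eulerRow f τ N j g prev k) (prev k)

/-- The randomized Euler approximation `y_k^j` (meaningful for `k ≤ N`) for a realization `g` of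
the random nodes: `g j k` is the number in `[0, 1]` used in the step from `t_k^j` to
`t_{k+1}^j`. The row with index `-1` is constant equal to `x₀`. -/
def randomizedEuler {d : ℕ} (f : ℝ → Vec d → Vec d → Vec d) (τ : ℝ) (x₀ : Vec d) (N : ℕ)
    (g : ℕ → ℕ → ℝ) : ℕ → ℕ → Vec d
  | 0 => eulerRow f τ N 0 (g 0) fun _ => x₀
  | j + 1 => eulerRow f τ N (j + 1) (g (j + 1)) (randomizedEuler f τ x₀ N g j)

/-- The maximal error `max_{0 ≤ j ≤ n} max_{0 ≤ i ≤ N} ‖x(t_i^j) - y_i^j‖`. -/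
def maxGridError {d : ℕ} (f : ℝ → Vec d → Vec d → Vec d) (τ : ℝ) (x₀ : Vec d) (n N : ℕ)
    (x : ℝ → Vec d) (g : ℕ → ℕ → ℝ) : ℝ :=
  (Finset.range (n + 1)).sup' Finset.nonempty_range_add_one fun j =>
    (Finset.range (N + 1)).sup' Finset.nonempty_range_add_one fun i =>
      ‖x (gridPoint τ N j i) - randomizedEuler f τ x₀ N g j i‖

end

/-! On a time set of full measure the data are bounded by one constant, so `f` may be replaced by a
right-hand side `g` that is uniformly Lipschitz at every time. Solutions do not notice the change,
and almost surely neither does the scheme: its countably many random nodes avoid a fixed null set.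
Existence is Picard iteration. Any solution is Lipschitz, and `F t = g t (X t) (X (t - τ))` is
bounded along it.

Pathwise, a discrete Gronwall argument on each delay interval (`norm_sub_eulerRow_le`,
`exists_norm_sub_randomizedEuler_le`) bounds the scheme error by `c * (D + τ / N)`, where `D` bounds
all partial sums of the quadrature errors of `F`. Since `F` is evaluated along the exact solution,
it is deterministic, so these sums have independent, centred terms of size `O(1/N)`.

By Hoeffding's lemma each coordinate `S` of a partial sum is sub-Gaussian with parameter at most `(τ
* B) ^ 2 / N`, hence `exp (√N * |S|)` has bounded mean. Adding these exponentials over all rows,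
partial sums and coordinates gives mean `O(N)`; after division by `N ^ 3` the total is summable in
`N`, and one integrable `W` serves every `N`. Taking logarithms, `√N * |S| ≤ 3 * log N + log (1 +
W)`: the first term costs `N ^ ε`, the second has all moments. -/

/-! ### Reduction to uniformly Lipschitz right-hand sides -/

/-- Carathéodory right-hand sides with a uniform bound at the origin and a uniform Lipschitz
constant. -/
structure IsUniformlyLipschitzRHS {d : ℕ} (C : ℝ) (g : ℝ → Vec d → Vec d → Vec d) : Prop where
  nonneg : 0 ≤ C
  measurable_time : ∀ x z, Measurable fun t => g t x z
  norm_zero_le : ∀ t, ‖g t 0 0‖ ≤ C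
  norm_sub_le : ∀ t x₁ x₂ z₁ z₂, ‖g t x₁ z₁ - g t x₂ z₂‖ ≤ C * (‖x₁ - x₂‖ + ‖z₁ - z₂‖)

theorem MeasureTheory.MemLp.exists_ae_norm_le_of_top {α E : Type*} [MeasurableSpace α]
    {μ : Measure α} [NormedAddCommGroup E] {f : α → E} (hf : MemLp f ∞ μ) :
    ∃ a : ℝ, ∀ᵐ t ∂μ, ‖f t‖ ≤ a := by
  have h := hf.eLpNorm_lt_top
  rw [eLpNorm_exponent_top] at h
  refine ⟨(eLpNormEssSup f μ).toReal, ?_⟩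
  filter_upwards [enorm_ae_le_eLpNormEssSup f μ] with t ht
  rw [← toReal_enorm]
  exact ENNReal.toReal_mono h.ne ht

theorem IsAdmissibleRHS.exists_uniformlyLipschitz {d : ℕ} {T : ℝ} (hT : 0 ≤ T)
    {f : ℝ → Vec d → Vec d → Vec d} (hf : IsAdmissibleRHS T ∞ 1 f) :
    ∃ C g, IsUniformlyLipschitzRHS C g ∧
      ∀ᵐ t ∂(volume.restrict (Icc 0 T)), ∀ x z, g t x z = f t x z := by
  classical
  obtain ⟨K, L, hK0, hL0, hK, hL, hfK, hfL⟩ := hf.bounds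
  obtain ⟨a, ha⟩ := hK.exists_ae_norm_le_of_top
  obtain ⟨b, hb⟩ := hL.exists_ae_norm_le_of_top
  set μ := (volume.restrict (Icc 0 T) : Measure ℝ)
  set C := max (max a b) 0
  have hgood : ∀ᵐ t ∂μ, t ∈ Icc 0 T ∧ K t ≤ C ∧ L t ≤ C := by
    filter_upwards [ha, hb, ae_restrict_mem measurableSet_Icc] with t h1 h2 h3
    exact ⟨h3, (le_abs_self _).trans (h1.trans ((le_max_left a b).trans (le_max_left _ _))),
      (le_abs_self _).trans (h2.trans ((le_max_right a b).trans (le_max_left _ _)))⟩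
  -- The set where the bounds hold need not be measurable; `A` is a measurable subset of it, still
  -- of full measure in `[0, T]`.
  set A : Set ℝ := (toMeasurable μ {t | ¬ (t ∈ Icc 0 T ∧ K t ≤ C ∧ L t ≤ C)})ᶜ
  have hAm : MeasurableSet A := (measurableSet_toMeasurable _ _).compl
  have hA : ∀ t ∈ A, t ∈ Icc 0 T ∧ K t ≤ C ∧ L t ≤ C := by
    intro t ht
    by_contra h
    exact ht (subset_toMeasurable _ _ h)
  have hAae : ∀ᵐ t ∂μ, t ∈ A := by
    rw [ae_iff]
    simp only [A, mem_compl_iff, not_not]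
    exact (measure_toMeasurable _).trans hgood
  have hC : 0 ≤ C := le_max_right _ _
  refine ⟨C, fun t x z => if t ∈ A then f t x z else 0, ⟨hC, ?_, ?_, ?_⟩, ?_⟩
  · intro x z
    have h := (hf.measurable_time x z).comp (continuous_projIcc (h := hT)).measurable
    convert h.indicator hAm using 1
    ext1 t
    by_cases ht : t ∈ A
    · simp [ht, projIcc_of_mem hT (hA t ht).1]
    · simp [ht]
  · intro t
    by_cases ht : t ∈ A
    · simpa [ht] using (hfK t (hA t ht).1).trans (hA t ht).2.1
    · simpa [ht] using hC
  · intro t x₁ x₂ z₁ z₂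
    by_cases ht : t ∈ A
    · have := hfL t (hA t ht).1 x₁ x₂ z₁ z₂
      rw [Real.rpow_one] at this
      simp only [ht, if_true]
      exact this.trans (mul_le_mul_of_nonneg_right (hA t ht).2.2 (by positivity))
    · simp only [ht, if_false, sub_zero, norm_zero]
      positivity
  · filter_upwards [hAae] with t ht x z
    simp [ht]

namespace IsUniformlyLipschitzRHS

variable {d : ℕ} {C : ℝ} {g : ℝ → Vec d → Vec d → Vec d}

theorem continuous_space (hg : IsUniformlyLipschitzRHS C g) (t : ℝ) :
    Continuous fun w : Vec d × Vec d => g t w.1 w.2 := by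
  refine (LipschitzWith.of_dist_le_mul (K := (2 * C).toNNReal) fun v w => ?_).continuous
  rw [dist_eq_norm, dist_eq_norm, Real.coe_toNNReal _ (by linarith [hg.nonneg])]
  have h1 := norm_fst_le (v - w)
  have h2 := norm_snd_le (v - w)
  refine (hg.norm_sub_le t _ _ _ _).trans ?_
  rw [Prod.fst_sub] at h1
  rw [Prod.snd_sub] at h2
  nlinarith [hg.nonneg]

theorem measurable_comp (hg : IsUniformlyLipschitzRHS C g) {u v : ℝ → Vec d}
    (hu : Measurable u) (hv : Measurable v) : Measurable fun t => g t (u t) (v t) := by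
  have h := measurable_uncurry_of_continuous_of_measurable
    (u := fun (w : Vec d × Vec d) t => g t w.1 w.2) hg.continuous_space
    fun w => hg.measurable_time w.1 w.2
  exact h.comp ((hu.prodMk hv).prodMk measurable_id)

theorem norm_le (hg : IsUniformlyLipschitzRHS C g) (t : ℝ) (x z : Vec d) :
    ‖g t x z‖ ≤ C * (1 + ‖x‖ + ‖z‖) := by
  have h := hg.norm_sub_le t x 0 z 0
  have h2 := norm_add_le (g t x z - g t 0 0) (g t 0 0)
  simp only [sub_add_cancel, sub_zero] at h h2
  linarith [hg.norm_zero_le t]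

/-- Along bounded measurable curves the right-hand side is interval integrable. -/
theorem intervalIntegrable_comp (hg : IsUniformlyLipschitzRHS C g) {u v : ℝ → Vec d} {M : ℝ}
    (hu : Measurable u) (hv : Measurable v) (hMu : ∀ t, ‖u t‖ ≤ M) (hMv : ∀ t, ‖v t‖ ≤ M)
    (a b : ℝ) : IntervalIntegrable (fun t => g t (u t) (v t)) volume a b := by
  refine (intervalIntegrable_const (c := C * (1 + M + M))).mono_fun
    (hg.measurable_comp hu hv).aestronglyMeasurable (ae_of_all _ fun t => ?_)
  refine (hg.norm_le t _ _).trans ((mul_le_mul_of_nonneg_left ?_ hg.nonneg).trans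
    (le_abs_self _))
  linarith [hMu t, hMv t]

end IsUniformlyLipschitzRHS

/-! ### Existence by Picard iteration -/

theorem intervalIntegral.absolutelyContinuousOnInterval_primitive_of_norm_le {E : Type*}
    [NormedAddCommGroup E] [NormedSpace ℝ E] {F : ℝ → E} {B : ℝ}
    (hF : ∀ a b, IntervalIntegrable F volume a b) (hB : ∀ t, ‖F t‖ ≤ B) (a b c : ℝ) :
    AbsolutelyContinuousOnInterval (fun t => ∫ s in c..t, F s) a b := by
  refine (LipschitzWith.of_dist_le_mul (K := B.toNNReal)
    fun s t => ?_).lipschitzOnWith.absolutelyContinuousOnInterval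
  rw [dist_eq_norm, intervalIntegral.integral_interval_sub_left (hF _ _) (hF _ _),
    Real.coe_toNNReal _ ((norm_nonneg _).trans (hB 0)), Real.dist_eq]
  exact intervalIntegral.norm_integral_le_of_norm_le_const fun r _ => hB r

namespace IsUniformlyLipschitzRHS

variable {d : ℕ} {C : ℝ} {g : ℝ → Vec d → Vec d → Vec d} {T τ : ℝ}

theorem intervalIntegrable_projIcc (hg : IsUniformlyLipschitzRHS C g) (hT : 0 ≤ T)
    (u : C(Icc (0 : ℝ) T, Vec d)) (a b : ℝ) :
    IntervalIntegrable (fun s => g s (u (projIcc 0 T hT s)) (u (projIcc 0 T hT (s - τ))))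
      volume a b := by
  have hu : Continuous fun s => u (projIcc 0 T hT s) := u.continuous.comp continuous_projIcc
  exact hg.intervalIntegrable_comp (M := ‖u‖) hu.measurable
    (hu.comp (continuous_sub_right τ)).measurable (fun _ => u.norm_coe_le_norm _)
    (fun _ => u.norm_coe_le_norm _) a b

/-- The Picard operator of the delay equation. Curves on `[0, T]` are extended by constants, which
is the right initial segment for curves starting at `x₀`. -/
noncomputable def picard (hg : IsUniformlyLipschitzRHS C g) (hT : 0 ≤ T) (τ : ℝ) (x₀ : Vec d)
    (u : C(Icc (0 : ℝ) T, Vec d)) : C(Icc (0 : ℝ) T, Vec d) where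
  toFun t := x₀ + ∫ s in (0 : ℝ)..t, g s (u (projIcc 0 T hT s)) (u (projIcc 0 T hT (s - τ)))
  continuous_toFun := continuous_const.add
    ((intervalIntegral.continuous_primitive (hg.intervalIntegrable_projIcc hT u) 0).comp
      continuous_subtype_val)

/-- The delayed time never exceeds the current one, so the inductive bound at `s` controls both
arguments of `g`; this is the factor `2 * C`. Integrating `s ^ k` produces the factorial. -/
theorem dist_iterate_picard_apply_le (hg : IsUniformlyLipschitzRHS C g) (hT : 0 ≤ T) (hτ : 0 ≤ τ)
    (x₀ : Vec d) (u v : C(Icc (0 : ℝ) T, Vec d)) (k : ℕ) (t : Icc (0 : ℝ) T) :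
    dist ((hg.picard hT τ x₀)^[k] u t) ((hg.picard hT τ x₀)^[k] v t) ≤
      (2 * C * t) ^ k / k.factorial * dist u v := by
  induction k generalizing t with
  | zero => simpa using ContinuousMap.dist_apply_le_dist t
  | succ k ih =>
    rw [Function.iterate_succ_apply', Function.iterate_succ_apply']
    set u' := (hg.picard hT τ x₀)^[k] u
    set v' := (hg.picard hT τ x₀)^[k] v
    have hC := hg.nonneg
    have hproj : ∀ s r : ℝ, 0 ≤ s → r ≤ s →
        ‖u' (projIcc 0 T hT r) - v' (projIcc 0 T hT r)‖ ≤
          (2 * C * s) ^ k / k.factorial * dist u v := by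
      intro s r hs hr
      rw [← dist_eq_norm]
      refine (ih _).trans ?_
      have h1 : ((projIcc 0 T hT r : Icc (0 : ℝ) T) : ℝ) ≤ s := by
        rw [coe_projIcc]
        exact max_le hs ((min_le_right _ _).trans hr)
      have h0 := (projIcc 0 T hT r).2.1
      gcongr
    have hbound : ∀ s ∈ Ioc (0 : ℝ) t,
        ‖g s (u' (projIcc 0 T hT s)) (u' (projIcc 0 T hT (s - τ))) -
          g s (v' (projIcc 0 T hT s)) (v' (projIcc 0 T hT (s - τ)))‖ ≤
        (2 * C) ^ (k + 1) / k.factorial * dist u v * s ^ k := by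
      intro s hs
      refine (hg.norm_sub_le s _ _ _ _).trans ?_
      have h1 := hproj s s hs.1.le le_rfl
      have h2 := hproj s (s - τ) hs.1.le (by linarith)
      calc C * _ ≤ C * ((2 * C * s) ^ k / k.factorial * dist u v +
            (2 * C * s) ^ k / k.factorial * dist u v) := by gcongr
        _ = _ := by rw [mul_pow (2 * C), pow_succ]; ring
    calc dist (hg.picard hT τ x₀ u' t) (hg.picard hT τ x₀ v' t)
        = ‖∫ s in (0 : ℝ)..t, (g s (u' (projIcc 0 T hT s)) (u' (projIcc 0 T hT (s - τ))) -
            g s (v' (projIcc 0 T hT s)) (v' (projIcc 0 T hT (s - τ))))‖ := by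
          rw [intervalIntegral.integral_sub (hg.intervalIntegrable_projIcc hT _ _ _)
            (hg.intervalIntegrable_projIcc hT _ _ _), dist_eq_norm]
          simp [picard]
      _ ≤ ∫ s in (0 : ℝ)..t, (2 * C) ^ (k + 1) / k.factorial * dist u v * s ^ k :=
          intervalIntegral.norm_integral_le_of_norm_le t.2.1 (ae_of_all _ hbound)
            (Continuous.intervalIntegrable (by fun_prop) _ _)
      _ = _ := by
          rw [intervalIntegral.integral_const_mul, integral_pow, Nat.factorial_succ]
          have : (k.factorial : ℝ) ≠ 0 := by positivity
          push_cast
          field_simp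
          ring

theorem exists_picard_eq (hg : IsUniformlyLipschitzRHS C g) (hT : 0 ≤ T) (hτ : 0 ≤ τ)
    (x₀ : Vec d) : ∃ u, hg.picard hT τ x₀ u = u := by
  have hC := hg.nonneg
  obtain ⟨k, hk⟩ := (FloorSemiring.tendsto_pow_div_factorial_atTop (2 * C * T)).eventually
    (gt_mem_nhds zero_lt_one) |>.exists
  have h0 : 0 ≤ (2 * C * T) ^ k / k.factorial := by positivity
  have hcontr : ContractingWith ⟨_, h0⟩ (hg.picard hT τ x₀)^[k] := by
    refine ⟨hk, LipschitzWith.of_dist_le_mul fun u v => ?_⟩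
    refine (ContinuousMap.dist_le (by positivity)).2 fun t => ?_
    refine (hg.dist_iterate_picard_apply_le hT hτ x₀ u v k t).trans ?_
    have h1 := t.2.1
    have h2 := t.2.2
    change _ ≤ (2 * C * T) ^ k / k.factorial * dist u v
    gcongr
  -- Uniqueness of the fixed point of the contracting iterate makes it a fixed point of the operator
  -- itself.
  exact ⟨_, hcontr.isFixedPt_fixedPoint_iterate⟩

theorem exists_isDelaySolution (hg : IsUniformlyLipschitzRHS C g) (hT : 0 ≤ T) (hτ : 0 ≤ τ)
    (x₀ : Vec d) : ∃ x, IsDelaySolution τ T x₀ g x := by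
  obtain ⟨u, hu⟩ := hg.exists_picard_eq hT hτ x₀
  set F : ℝ → Vec d := fun s => g s (u (projIcc 0 T hT s)) (u (projIcc 0 T hT (s - τ))) with hF
  have hint : ∀ a b, IntervalIntegrable F volume a b := hg.intervalIntegrable_projIcc hT u
  have hval : ∀ t : Icc (0 : ℝ) T, u t = x₀ + ∫ s in (0 : ℝ)..t, F s := fun t => by
    conv_lhs => rw [← hu]
    rfl
  -- Clamping at `0` supplies the constant history. It may create a kink at `0`, so that time is
  -- discarded below.
  set x : ℝ → Vec d := fun t => x₀ + ∫ s in (0 : ℝ)..max t 0, F s with hx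
  have hxu : ∀ t ≤ T, u (projIcc 0 T hT t) = x t := by
    intro t ht
    rw [hval, coe_projIcc, min_eq_right ht, max_comm]
  have hB : ∀ t, ‖F t‖ ≤ C * (1 + ‖u‖ + ‖u‖) := by
    intro t
    refine (hg.norm_le t _ _).trans (mul_le_mul_of_nonneg_left ?_ hg.nonneg)
    gcongr <;> exact u.norm_coe_le_norm _
  have hac := intervalIntegral.absolutelyContinuousOnInterval_primitive_of_norm_le hint hB 0 T 0
  refine ⟨x, ?_, ?_, ?_⟩
  · intro t ht
    simp [hx, ht.2]
  · rw [absolutelyContinuousOnInterval_iff] at hac ⊢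
    intro ε hε
    obtain ⟨δ, hδ, h⟩ := hac ε hε
    refine ⟨δ, hδ, fun E hE hEδ => ?_⟩
    refine lt_of_eq_of_lt (Finset.sum_congr rfl fun i hi => ?_) (h E hE hEδ)
    obtain ⟨h1, h2⟩ := hE.1 i hi
    rw [uIcc_of_le hT] at h1 h2
    simp only [hx, dist_add_left, max_eq_left h1.1, max_eq_left h2.1]
  · rw [ae_restrict_iff' measurableSet_Icc]
    have h0 : ∀ᵐ t : ℝ, t ≠ 0 := by simp [ae_iff, measure_singleton]
    filter_upwards [(hint 0 T).ae_hasDerivAt_integral, h0] with t ht ht0 htT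
    have htpos : 0 < t := lt_of_le_of_ne htT.1 (Ne.symm ht0)
    have h1 := (ht (by rwa [uIcc_of_le hT]) 0 (by simp)).const_add x₀
    rw [← hxu t htT.2, ← hxu (t - τ) (by linarith [htT.2])]
    refine h1.congr_of_eventuallyEq ?_
    filter_upwards [lt_mem_nhds htpos] with s hs
    simp only [hx, max_eq_left hs.le]

end IsUniformlyLipschitzRHS

/-! ### Integral equation and Lipschitz regularity of solutions -/

/-- A solution on `[-τ, T]`, extended to the line by constants, is bounded with a bounded
right-hand side; it satisfies the integral equation and is Lipschitz. -/
theorem IsDelaySolution.exists_extension {d : ℕ} {C T τ : ℝ} {x₀ : Vec d}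
    {g : ℝ → Vec d → Vec d → Vec d} {x : ℝ → Vec d} (hx : IsDelaySolution τ T x₀ g x)
    (hg : IsUniformlyLipschitzRHS C g) (hT : 0 ≤ T) (hτ : 0 ≤ τ) :
    ∃ (X : ℝ → Vec d) (B : ℝ), (∀ t ∈ Icc (-τ) T, X t = x t) ∧
      Measurable (fun t => g t (X t) (X (t - τ))) ∧
      (∀ t, ‖g t (X t) (X (t - τ))‖ ≤ B) ∧
      (∀ a ∈ Icc 0 T, ∀ b ∈ Icc 0 T, X b - X a = ∫ t in a..b, g t (X t) (X (t - τ))) ∧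
      ∀ s t, ‖X s - X t‖ ≤ B * |s - t| := by
  have hc : Continuous fun t => x (projIcc 0 T hT t) := by
    have h := hx.absolutelyContinuous.continuousOn
    rw [uIcc_of_le hT, continuousOn_iff_continuous_domRestrict] at h
    exact h.comp continuous_projIcc
  obtain ⟨M, hM⟩ := hx.absolutelyContinuous.exists_bound
  rw [uIcc_of_le hT] at hM
  set X : ℝ → Vec d := fun t => x (projIcc 0 T hT t) with hX
  have hXM : ∀ t, ‖X t‖ ≤ M := fun t => hM _ (projIcc 0 T hT t).2
  have hpos : ∀ t ∈ Icc 0 T, X t = x t := fun t ht => by simp only [hX, projIcc_of_mem hT ht]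
  have hall : ∀ t ∈ Icc (-τ) T, X t = x t := by
    intro t ht
    rcases le_total 0 t with h | h
    · exact hpos t ⟨h, ht.2⟩
    · simp only [hX, projIcc_of_le_left hT h]
      rw [hx.initial t ⟨ht.1, h⟩, hx.initial 0 ⟨by linarith, le_rfl⟩]
  set F : ℝ → Vec d := fun t => g t (X t) (X (t - τ)) with hF
  have hcτ : Continuous fun t => X (t - τ) := hc.comp (continuous_sub_right τ)
  have hint : ∀ a b, IntervalIntegrable F volume a b :=
    hg.intervalIntegrable_comp hc.measurable hcτ.measurable hXM fun t => hXM _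
  have hFB : ∀ t, ‖F t‖ ≤ C * (1 + M + M) := by
    intro t
    refine (hg.norm_le t _ _).trans (mul_le_mul_of_nonneg_left ?_ hg.nonneg)
    gcongr <;> exact hXM _
  have hac := intervalIntegral.absolutelyContinuousOnInterval_primitive_of_norm_le hint hFB 0 T 0
  -- The solution minus the primitive of `F` is absolutely continuous with derivative zero almost
  -- everywhere, hence constant.
  have hder : ∀ᵐ t, t ∈ uIcc 0 T →
      HasDerivAt (x - fun t => ∫ s in (0 : ℝ)..t, F s) 0 t := by
    have h := hx.hasDerivAt
    rw [ae_restrict_iff' measurableSet_Icc] at h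
    filter_upwards [h, (hint 0 T).ae_hasDerivAt_integral] with t h1 h2 ht
    have ht' := ht
    rw [uIcc_of_le hT] at ht'
    have h3 := (h1 ht').sub (h2 ht 0 (by simp))
    have h4 : F t = g t (x t) (x (t - τ)) := by
      simp only [hF]
      rw [hall t ⟨by linarith [ht'.1], ht'.2⟩,
        hall (t - τ) ⟨by linarith [ht'.1], by linarith [ht'.2]⟩]
    rwa [h4, sub_self] at h3
  obtain ⟨c, hc'⟩ := (hx.absolutelyContinuous.sub hac).const_of_ae_hasDerivAt_zero hder
  rw [uIcc_of_le hT] at hc'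
  have heq : ∀ a ∈ Icc 0 T, ∀ b ∈ Icc 0 T, X b - X a = ∫ t in a..b, F t := by
    intro a ha b hb
    have h1 := (hc' a ha).trans (hc' b hb).symm
    simp only [Pi.sub_apply] at h1
    rw [hpos a ha, hpos b hb, ← intervalIntegral.integral_interval_sub_left (hint 0 b) (hint 0 a)]
    linear_combination (norm := module) -h1
  refine ⟨X, C * (1 + M + M), hall, hg.measurable_comp hc.measurable hcτ.measurable, hFB, heq, ?_⟩
  intro s t
  have h1 : X s - X t = ∫ r in ((projIcc 0 T hT t : Icc 0 T) : ℝ)..projIcc 0 T hT s, F r := by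
    rw [← heq _ (projIcc 0 T hT t).2 _ (projIcc 0 T hT s).2]
    simp only [hX, projIcc_val]
  rw [h1]
  refine (intervalIntegral.norm_integral_le_of_norm_le_const fun r _ => hFB r).trans ?_
  refine mul_le_mul_of_nonneg_left ?_ ((norm_nonneg _).trans (hFB 0))
  have := abs_projIcc_sub_projIcc (c := s) (d := t) hT
  exact this

/-! ### Deterministic error propagation -/

/-- Discrete Gronwall: the majorant on the right of `h` grows by at most the factor `1 + c` per
step, whatever the sign of `u`. -/
theorem le_mul_exp_of_le_add_sum {u : ℕ → ℝ} {a c : ℝ} {N : ℕ} (hc : 0 ≤ c) (ha : 0 ≤ a)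
    (h : ∀ k ≤ N, u k ≤ a + ∑ i ∈ Finset.range k, c * u i) (k : ℕ) (hk : k ≤ N) :
    u k ≤ a * Real.exp (N * c) := by
  have key : ∀ k ≤ N + 1, a + ∑ i ∈ Finset.range k, c * u i ≤ a * (1 + c) ^ k := by
    intro k
    induction k with
    | zero => simp
    | succ k ih =>
      intro hk
      have h1 := ih (by omega)
      have h2 := h k (by omega)
      rw [Finset.sum_range_succ, pow_succ]
      nlinarith [mul_le_mul_of_nonneg_left (h2.trans h1) hc]
  refine (h k hk).trans ((key k (by omega)).trans (mul_le_mul_of_nonneg_left ?_ ha))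
  calc (1 + c) ^ k ≤ (1 + c) ^ N := pow_le_pow_right₀ (by linarith) hk
    _ ≤ Real.exp c ^ N := by
        gcongr
        linarith [Real.add_one_le_exp c]
    _ = _ := by rw [← Real.exp_nat_mul]

theorem gridPoint_succ (τ : ℝ) (N j k : ℕ) :
    gridPoint τ N j (k + 1) = gridPoint τ N j k + τ / N := by
  simp only [gridPoint]
  push_cast
  ring

theorem gridPoint_add_one_sub {τ : ℝ} (N j k : ℕ) :
    gridPoint τ N (j + 1) k - τ = gridPoint τ N j k := by
  simp only [gridPoint]
  push_cast
  ring

theorem gridPoint_add_one_zero {τ : ℝ} {N : ℕ} (hN : N ≠ 0) (j : ℕ) :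
    gridPoint τ N (j + 1) 0 = gridPoint τ N j N := by
  have : (N : ℝ) ≠ 0 := by exact_mod_cast hN
  simp only [gridPoint]
  push_cast
  field_simp
  ring

theorem gridPoint_mem_Icc {τ : ℝ} (hτ : 0 ≤ τ) {n N j k : ℕ} (hj : j ≤ n) (hk : k ≤ N) :
    gridPoint τ N j k ∈ Icc 0 (((n : ℝ) + 1) * τ) := by
  have h1 : (k : ℝ) * (τ / N) ≤ τ := by
    rcases Nat.eq_zero_or_pos N with rfl | hN
    · simpa using hτ
    · have hN' : (0 : ℝ) < N := by exact_mod_cast hN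
      calc (k : ℝ) * (τ / N) ≤ N * (τ / N) := by gcongr
        _ = τ := by field_simp
  have h2 : (j : ℝ) * τ ≤ n * τ := by gcongr
  refine ⟨?_, ?_⟩ <;> simp only [gridPoint]
  · positivity
  · linarith

/-- The local quadrature error of the randomized rectangle rule for `F` on the step from `t_k^j`
to `t_{k+1}^j`, with random node `t_k^j + h r`. -/
noncomputable def quadError {d : ℕ} (F : ℝ → Vec d) (τ : ℝ) (N j k : ℕ) (r : ℝ) : Vec d :=
  (∫ t in gridPoint τ N j k..gridPoint τ N j (k + 1), F t) -
    (τ / N) • F (gridPoint τ N j k + (τ / N) * r)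

section EulerError

variable {d : ℕ} {C τ B : ℝ} {g : ℝ → Vec d → Vec d → Vec d} {X : ℝ → Vec d}

/-- The error splits into the starting error, the quadrature errors along the exact solution, and
the Lipschitz increments `δ`. The quadrature errors stay inside one norm, so their cancellation is
kept. Moving from a random node to its grid point costs `B * h` in each argument, whence `2 * B`. -/
theorem norm_sub_eulerRow_le (hg : IsUniformlyLipschitzRHS C g) (hτ : 0 ≤ τ) {N : ℕ} (hN : N ≠ 0)
    (hLip : ∀ s t, ‖X s - X t‖ ≤ B * |s - t|) (j : ℕ) {r : ℕ → ℝ}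
    (hr : ∀ k < N, r k ∈ Icc (0 : ℝ) 1)
    (hint : ∀ k < N, X (gridPoint τ N j (k + 1)) - X (gridPoint τ N j k) =
      ∫ t in gridPoint τ N j k..gridPoint τ N j (k + 1), g t (X t) (X (t - τ)))
    {prev : ℕ → Vec d} {M D : ℝ}
    (hprev : ∀ k ≤ N, ‖X (gridPoint τ N j k - τ) - prev k‖ ≤ M)
    (h_start : ‖X (gridPoint τ N j 0) - prev N‖ ≤ M)
    (hD : ∀ k ≤ N, ‖∑ i ∈ Finset.range k,
      quadError (fun t => g t (X t) (X (t - τ))) τ N j i (r i)‖ ≤ D)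
    (k : ℕ) (hk : k ≤ N) :
    ‖X (gridPoint τ N j k) - eulerRow g τ N j r prev k‖ ≤
      (M + D + C * τ * (M + 2 * B * (τ / N))) * Real.exp (C * τ) := by
  set h : ℝ := τ / N with hh
  have hNpos : (0 : ℝ) < N := by positivity
  have hh0 : 0 ≤ h := by positivity
  have hNh : N * h = τ := by rw [hh]; field_simp
  have hC := hg.nonneg
  have hM : 0 ≤ M := (norm_nonneg _).trans h_start
  have hD0 : 0 ≤ D := (norm_nonneg _).trans (hD 0 (Nat.zero_le _))
  have hB : 0 ≤ B := by simpa using (norm_nonneg _).trans (hLip 1 0)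
  set y := eulerRow g τ N j r prev
  set θ : ℕ → ℝ := fun i => gridPoint τ N j i + h * r i with hθ
  set δ : ℕ → Vec d := fun i =>
    h • (g (θ i) (X (θ i)) (X (θ i - τ)) - g (θ i) (y i) (prev i)) with hδ
  have hdecomp : ∀ k ≤ N, X (gridPoint τ N j k) - y k = (X (gridPoint τ N j 0) - prev N) +
      ∑ i ∈ Finset.range k, quadError (fun t => g t (X t) (X (t - τ))) τ N j i (r i) +
      ∑ i ∈ Finset.range k, δ i := by
    intro k
    induction k with
    | zero => intro _; simp [y, eulerRow]
    | succ k ih =>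
      intro hk
      have h1 := ih (by omega)
      have h2 := hint k (by omega)
      have h3 : y (k + 1) = y k + h • g (θ k) (y k) (prev k) := rfl
      rw [Finset.sum_range_succ, Finset.sum_range_succ, h3]
      simp only [quadError, ← h2, hδ, smul_sub, ← hh] at h1 ⊢
      linear_combination (norm := module) h1
  have hδle : ∀ i < N, ‖δ i‖ ≤ h * C * (M + 2 * B * h) +
      h * C * ‖X (gridPoint τ N j i) - y i‖ := by
    intro i hi
    have hri := hr i hi
    have hclose : ∀ s, ‖X (s + h * r i) - X s‖ ≤ B * h := by
      intro s
      refine (hLip _ _).trans (mul_le_mul_of_nonneg_left ?_ hB)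
      rw [add_sub_cancel_left, abs_of_nonneg (mul_nonneg hh0 hri.1)]
      nlinarith [hri.2]
    have h1 : ‖X (θ i) - y i‖ ≤ B * h + ‖X (gridPoint τ N j i) - y i‖ :=
      (norm_sub_le_norm_sub_add_norm_sub _ (X (gridPoint τ N j i)) _).trans
        (add_le_add_left (hclose _) _)
    have h2 : ‖X (θ i - τ) - prev i‖ ≤ B * h + M := by
      refine (norm_sub_le_norm_sub_add_norm_sub _ (X (gridPoint τ N j i - τ)) _).trans
        (add_le_add ?_ (hprev i hi.le))
      have := hclose (gridPoint τ N j i - τ)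
      rwa [show gridPoint τ N j i - τ + h * r i = θ i - τ by simp only [hθ]; ring] at this
    rw [hδ, norm_smul, Real.norm_of_nonneg hh0]
    calc _ ≤ h * (C * ((B * h + ‖X (gridPoint τ N j i) - y i‖) + (B * h + M))) := by
          gcongr
          exact (hg.norm_sub_le _ _ _ _ _).trans (by gcongr)
      _ = _ := by ring
  have hu : ∀ k ≤ N, ‖X (gridPoint τ N j k) - y k‖ ≤ (M + D + C * τ * (M + 2 * B * h)) +
      ∑ i ∈ Finset.range k, h * C * ‖X (gridPoint τ N j i) - y i‖ := by
    intro k hk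
    rw [hdecomp k hk]
    have h1 : ‖∑ i ∈ Finset.range k, δ i‖ ≤ C * τ * (M + 2 * B * h) +
        ∑ i ∈ Finset.range k, h * C * ‖X (gridPoint τ N j i) - y i‖ := by
      refine (norm_sum_le _ _).trans ((Finset.sum_le_sum fun i hi =>
        hδle i (by have := Finset.mem_range.1 hi; omega)).trans ?_)
      rw [Finset.sum_add_distrib, Finset.sum_const, Finset.card_range, nsmul_eq_mul]
      have hkN : (k : ℝ) * h ≤ τ := by
        rw [← hNh]
        gcongr
      refine add_le_add_left ?_ _
      calc (k : ℝ) * (h * C * (M + 2 * B * h)) = C * (k * h) * (M + 2 * B * h) := by ring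
        _ ≤ _ := by gcongr
    refine (norm_add₃_le).trans ?_
    linarith [hD k hk]
  have := le_mul_exp_of_le_add_sum (by positivity) (by positivity) hu k hk
  rwa [show (N : ℝ) * (h * C) = C * τ by rw [← hNh]; ring] at this

theorem exists_norm_sub_randomizedEuler_le (hg : IsUniformlyLipschitzRHS C g) (hτ : 0 ≤ τ)
    {x₀ : Vec d} {n : ℕ} (hX₀ : ∀ t ∈ Icc (-τ) 0, X t = x₀)
    (hLip : ∀ s t, ‖X s - X t‖ ≤ B * |s - t|)
    (hint : ∀ a ∈ Icc 0 (((n : ℝ) + 1) * τ), ∀ b ∈ Icc 0 (((n : ℝ) + 1) * τ),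
      X b - X a = ∫ t in a..b, g t (X t) (X (t - τ))) :
    ∃ c, 0 ≤ c ∧ ∀ (N : ℕ) (r : ℕ → ℕ → ℝ) (D : ℝ), N ≠ 0 →
      (∀ j ≤ n, ∀ k < N, r j k ∈ Icc (0 : ℝ) 1) →
      (∀ j ≤ n, ∀ k ≤ N, ‖∑ i ∈ Finset.range k,
        quadError (fun t => g t (X t) (X (t - τ))) τ N j i (r j i)‖ ≤ D) →
      ∀ j ≤ n, ∀ k ≤ N,
        ‖X (gridPoint τ N j k) - randomizedEuler g τ x₀ N r j k‖ ≤ c * (D + τ / N) := by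
  have hC := hg.nonneg
  have hB : 0 ≤ B := by simpa using (norm_nonneg _).trans (hLip 1 0)
  have hrow : ∀ (c : ℝ) (N j : ℕ) (r : ℕ → ℝ) (D : ℝ) (prev : ℕ → Vec d), N ≠ 0 → j ≤ n → 0 ≤ c →
      (∀ k < N, r k ∈ Icc (0 : ℝ) 1) →
      (∀ k ≤ N, ‖∑ i ∈ Finset.range k,
        quadError (fun t => g t (X t) (X (t - τ))) τ N j i (r i)‖ ≤ D) →
      (∀ k ≤ N, ‖X (gridPoint τ N j k - τ) - prev k‖ ≤ c * (D + τ / N)) →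
      (‖X (gridPoint τ N j 0) - prev N‖ ≤ c * (D + τ / N)) →
      ∀ k ≤ N, ‖X (gridPoint τ N j k) - eulerRow g τ N j r prev k‖ ≤
        ((c + 1 + C * τ * (c + 2 * B)) * Real.exp (C * τ)) * (D + τ / N) := by
    intro c N j r D prev hN hj hc hr hD hprev h_start k hk
    have hD0 : 0 ≤ D := (norm_nonneg _).trans (hD 0 (Nat.zero_le _))
    refine (norm_sub_eulerRow_le hg hτ hN hLip j hr (fun k hk => hint _
      (gridPoint_mem_Icc hτ hj hk.le) _ (gridPoint_mem_Icc hτ hj hk)) hprev h_start hD k hk).trans ?_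
    rw [mul_right_comm (c + 1 + _)]
    refine mul_le_mul_of_nonneg_right ?_ (Real.exp_nonneg _)
    -- The right side minus the left is `τ / N + 2 * C * τ * B * D`.
    have h1 : 0 ≤ C * τ * B * D := by positivity
    have h2 : 0 ≤ τ / N := by positivity
    nlinarith
  -- The constant grows from row to row, as the bound for one row feeds both the starting value and
  -- the delayed argument of the next.
  suffices H : ∀ m ≤ n, ∃ c, 0 ≤ c ∧ ∀ (N : ℕ) (r : ℕ → ℕ → ℝ) (D : ℝ), N ≠ 0 →
      (∀ j ≤ n, ∀ k < N, r j k ∈ Icc (0 : ℝ) 1) →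
      (∀ j ≤ n, ∀ k ≤ N, ‖∑ i ∈ Finset.range k,
        quadError (fun t => g t (X t) (X (t - τ))) τ N j i (r j i)‖ ≤ D) →
      ∀ j ≤ m, ∀ k ≤ N,
        ‖X (gridPoint τ N j k) - randomizedEuler g τ x₀ N r j k‖ ≤ c * (D + τ / N) from
    H n le_rfl
  intro m
  induction m with
  | zero =>
    intro _
    refine ⟨(0 + 1 + C * τ * (0 + 2 * B)) * Real.exp (C * τ), by positivity, ?_⟩
    intro N r D hN hr hD j hj
    obtain rfl : j = 0 := by omega
    have hgrid : ∀ k ≤ N, gridPoint τ N 0 k ∈ Icc 0 τ := fun k hk => by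
      simpa using gridPoint_mem_Icc (n := 0) hτ le_rfl hk
    -- The history is exact, so row `0` starts from the constant `0`.
    refine hrow 0 N 0 (r 0) D _ hN (Nat.zero_le _) le_rfl (hr 0 (Nat.zero_le _))
      (hD 0 (Nat.zero_le _)) ?_ ?_
    · intro k hk
      rw [hX₀ _ ⟨by linarith [(hgrid k hk).1], by linarith [(hgrid k hk).2]⟩]
      simp
    · rw [hX₀ _ ⟨by linarith [(hgrid 0 (Nat.zero_le _)).1], by simp [gridPoint]⟩]
      simp
  | succ m ih =>
    intro hm
    obtain ⟨c, hc, H⟩ := ih (by omega)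
    refine ⟨max c ((c + 1 + C * τ * (c + 2 * B)) * Real.exp (C * τ)),
      hc.trans (le_max_left _ _), ?_⟩
    intro N r D hN hr hD j hj k hk
    have hD0 : 0 ≤ D := (norm_nonneg _).trans (hD 0 (Nat.zero_le _) 0 (Nat.zero_le _))
    have hDτ : 0 ≤ D + τ / N := by positivity
    have hprev := H N r D hN hr hD
    rcases Nat.lt_or_ge m j with h | h
    · obtain rfl : j = m + 1 := by omega
      refine (hrow c N (m + 1) (r (m + 1)) D _ hN hm hc (hr _ hm) (hD _ hm) ?_ ?_ k hk).trans
        (mul_le_mul_of_nonneg_right (le_max_right _ _) hDτ)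
      · intro k hk
        rw [gridPoint_add_one_sub]
        exact hprev m le_rfl k hk
      · rw [gridPoint_add_one_zero hN]
        exact hprev m le_rfl N le_rfl
    · exact (hprev j h k hk).trans (mul_le_mul_of_nonneg_right (le_max_left _ _) hDτ)

end EulerError

/-! ### Sub-Gaussian quadrature errors -/

theorem EuclideanSpace.norm_le_sum_abs {ι : Type*} [Fintype ι] (v : EuclideanSpace ℝ ι) :
    ‖v‖ ≤ ∑ i, |v i| := by
  rw [EuclideanSpace.norm_eq]
  refine Real.sqrt_le_iff.2 ⟨Finset.sum_nonneg fun _ _ => abs_nonneg _, ?_⟩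
  exact Finset.sum_sq_le_sq_sum_of_nonneg fun _ _ => abs_nonneg _

section Uniform

variable {Ω : Type*} [MeasurableSpace Ω] {P : Measure Ω} {U : Ω → ℝ}

theorem MeasureTheory.pdf.IsUniform.map_eq_restrict_Icc (hU : pdf.IsUniform U (Icc 0 1) P volume) :
    P.map U = volume.restrict (Icc 0 1) := by
  have h : P.map U = ProbabilityTheory.cond volume (Icc (0 : ℝ) 1) := hU
  rw [h, ProbabilityTheory.cond]
  simp

theorem integral_comp_affine_of_isUniform (hm : Measurable U)
    (hU : pdf.IsUniform U (Icc 0 1) P volume) {φ : ℝ → ℝ} (hφ : Measurable φ) (a h : ℝ) :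
    ∫ ω, h * φ (a + h * U ω) ∂P = ∫ t in a..(a + h), φ t := by
  have hmeas : Measurable fun u => h * φ (a + h * u) := by fun_prop
  rw [← integral_map (φ := U) (f := fun u => h * φ (a + h * u)) hm.aemeasurable
    hmeas.aestronglyMeasurable, hU.map_eq_restrict_Icc, integral_Icc_eq_integral_Ioc,
    ← intervalIntegral.integral_of_le zero_le_one, intervalIntegral.integral_const_mul]
  simp

/-- The error of the one-point randomized rectangle rule is sub-Gaussian. -/
theorem hasSubgaussianMGF_randomized_rectangle [IsProbabilityMeasure P] (hm : Measurable U)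
    (hU : pdf.IsUniform U (Icc 0 1) P volume) {φ : ℝ → ℝ} (hφ : Measurable φ) {B : ℝ}
    (hB : ∀ t, |φ t| ≤ B) (a h : ℝ) :
    HasSubgaussianMGF (fun ω => (∫ t in a..(a + h), φ t) - h * φ (a + h * U ω))
      (‖h * B‖₊ ^ 2) P := by
  have hY : Measurable fun ω => h * φ (a + h * U ω) := by fun_prop
  have hb : ∀ ω, h * φ (a + h * U ω) ∈ Icc (-|h * B|) |h * B| := fun ω => by
    refine abs_le.1 ?_
    rw [abs_mul, abs_mul]
    exact mul_le_mul_of_nonneg_left ((hB _).trans (le_abs_self _)) (abs_nonneg _)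
  -- Hoeffding's lemma: the parameter is the square of half the interval length `2 * |h * B|`. The
  -- rule is unbiased, so centring subtracts the exact integral.
  have key := (hasSubgaussianMGF_of_mem_Icc hY.aemeasurable (ae_of_all P hb)).neg
  rw [integral_comp_affine_of_isUniform hm hU hφ] at key
  convert key using 1
  · ext ω
    simp
  · congr 1
    ext
    simp only [sub_neg_eq_add, NNReal.coe_div, coe_nnnorm, Real.norm_eq_abs, NNReal.coe_ofNat]
    rw [← two_mul, abs_mul 2, abs_abs]
    simp

end Uniform

/-! ### One random bound for all step numbers -/

/-- Nonnegative random variables with means growing at most linearly are simultaneously dominated,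
up to a cubic factor, by one integrable random variable. -/
theorem exists_integrable_forall_le_pow_three_mul {Ω : Type*} [MeasurableSpace Ω] {P : Measure Ω}
    {w : ℕ → Ω → ℝ} (hw : ∀ N, Measurable (w N)) (hw0 : ∀ N ω, 0 ≤ w N ω)
    (hwi : ∀ N, Integrable (w N) P) {A : ℝ} (hA : ∀ N, N ≠ 0 → ∫ ω, w N ω ∂P ≤ A * N) :
    ∃ W : Ω → ℝ, Measurable W ∧ (∀ ω, 0 ≤ W ω) ∧ Integrable W P ∧
      ∀ᵐ ω ∂P, ∀ N : ℕ, N ≠ 0 → w N ω ≤ (N : ℝ) ^ 3 * W ω := by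
  set v : ℕ → Ω → ℝ≥0∞ := fun N ω => ENNReal.ofReal (w N ω / (N : ℝ) ^ 3) with hv
  have hvm : ∀ N, Measurable (v N) := fun N => ((hw N).div_const _).ennreal_ofReal
  have hfin : ∫⁻ ω, ∑' N, v N ω ∂P ≠ ∞ := by
    rw [lintegral_tsum fun N => (hvm N).aemeasurable]
    -- Linear means divided by `N ^ 3` leave the summable `A / N ^ 2`; the term `N = 0` vanishes
    -- because division by zero gives zero.
    have hle : ∀ N, ∫⁻ ω, v N ω ∂P ≤ ENNReal.ofReal (A * (1 / (N : ℝ) ^ 2)) := by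
      intro N
      rcases eq_or_ne N 0 with rfl | hN
      · simp [hv]
      rw [← ofReal_integral_eq_lintegral_ofReal ((hwi N).div_const _)
        (ae_of_all _ fun ω => div_nonneg (hw0 N ω) (by positivity))]
      refine ENNReal.ofReal_le_ofReal ?_
      rw [integral_div, div_le_iff₀ (by positivity)]
      refine (hA N hN).trans (le_of_eq ?_)
      field_simp
    have hs : Summable fun N : ℕ => A * (1 / (N : ℝ) ^ 2) :=
      (Real.summable_one_div_nat_pow.2 (by norm_num)).mul_left A
    exact ne_top_of_le_ne_top hs.tsum_ofReal_ne_top (ENNReal.tsum_le_tsum hle)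
  have hVm : Measurable fun ω => ∑' N, v N ω := Measurable.tsum hvm
  refine ⟨fun ω => (∑' N, v N ω).toReal, hVm.ennreal_toReal, fun _ => ENNReal.toReal_nonneg,
    integrable_toReal_of_lintegral_ne_top hVm.aemeasurable hfin, ?_⟩
  filter_upwards [ae_lt_top hVm hfin] with ω hω N hN
  have h1 := ENNReal.toReal_mono hω.ne (ENNReal.le_tsum (f := fun N => v N ω) N)
  rw [hv] at h1
  simp only at h1
  rw [ENNReal.toReal_ofReal (div_nonneg (hw0 N ω) (by positivity)),
    div_le_iff₀ (by positivity), mul_comm] at h1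
  exact h1

/-- `log (1 + W)` is at most `q * (1 + W) ^ (1 / q)`, whose `q`-th power is a multiple of the
integrable `1 + W`. -/
theorem memLp_log_one_add {Ω : Type*} [MeasurableSpace Ω] {P : Measure Ω} [IsFiniteMeasure P]
    {W : Ω → ℝ} (hW : Measurable W) (hW0 : ∀ ω, 0 ≤ W ω) (hWi : Integrable W P) {q : ℝ}
    (hq : 0 < q) : MemLp (fun ω => Real.log (1 + W ω)) (ENNReal.ofReal q) P := by
  have h1 : MemLp (fun ω => (1 + W ω) ^ (1 / q)) (ENNReal.ofReal q) P := by
    rw [← integrable_norm_rpow_iff ((hW.const_add 1).pow_const _).aestronglyMeasurable (by simpa using hq) ENNReal.ofReal_ne_top,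
      ENNReal.toReal_ofReal hq.le]
    refine ((integrable_const 1).add hWi).congr (ae_of_all _ fun ω => ?_)
    have h0 : 0 ≤ 1 + W ω := by linarith [hW0 ω]
    simp only [Pi.add_apply]
    rw [Real.norm_of_nonneg (by positivity), ← Real.rpow_mul h0, one_div_mul_cancel hq.ne',
      Real.rpow_one]
  refine (h1.const_mul q).mono (hW.const_add 1).log.aestronglyMeasurable (ae_of_all _ fun ω => ?_)
  have h2 : 1 ≤ 1 + W ω := by linarith [hW0 ω]
  rw [Real.norm_of_nonneg (Real.log_nonneg h2)]
  refine le_trans ?_ (le_abs_self _)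
  refine (Real.log_le_rpow_div (by linarith) (by positivity : 0 < 1 / q)).trans (le_of_eq ?_)
  field_simp

section QuadError

variable {d : ℕ} {τ B : ℝ} {F : ℝ → Vec d} {Ω : Type*} [MeasurableSpace Ω] {P : Measure Ω}

theorem quadError_apply (hF : Measurable F) (hB : ∀ t, ‖F t‖ ≤ B) (N j k : ℕ) (r : ℝ)
    (c : Fin d) : quadError F τ N j k r c =
      (∫ t in gridPoint τ N j k..(gridPoint τ N j k + τ / N), F t c) -
        (τ / N) * F (gridPoint τ N j k + (τ / N) * r) c := by
  have hint : IntervalIntegrable F volume (gridPoint τ N j k) (gridPoint τ N j k + τ / N) :=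
    (intervalIntegrable_const (c := B)).mono_fun hF.aestronglyMeasurable
      (ae_of_all _ fun t => (hB t).trans (le_abs_self _))
  have := (EuclideanSpace.proj c : Vec d →L[ℝ] ℝ).intervalIntegral_comp_comm hint
  simp only [PiLp.proj_apply] at this
  rw [quadError, gridPoint_succ, PiLp.sub_apply, this, PiLp.smul_apply, smul_eq_mul]

variable [IsProbabilityMeasure P] {γ : ℕ → ℕ → Ω → ℝ}

/-- Each summand involves its own node only, so the summands are independent and their parameters
add. -/
theorem hasSubgaussianMGF_sum_quadError (hγ_meas : ∀ j k, Measurable (γ j k))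
    (hγ_indep : iIndepFun (fun (jk : ℕ × ℕ) => γ jk.1 jk.2) P)
    (hγ_unif : ∀ j k, pdf.IsUniform (γ j k) (Icc 0 1) P volume)
    (hF : Measurable F) (hB : ∀ t, ‖F t‖ ≤ B) (N j k : ℕ) (c : Fin d) :
    HasSubgaussianMGF (fun ω => ∑ i ∈ Finset.range k, quadError F τ N j i (γ j i ω) c)
      (k * ‖τ / N * B‖₊ ^ 2) P := by
  have hFc : Measurable fun t => F t c := by fun_prop
  have hBc : ∀ t, |F t c| ≤ B := fun t => (PiLp.norm_apply_le (F t) c).trans (hB t)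
  have hind : iIndepFun (fun i => γ j i) P :=
    hγ_indep.precomp (g := fun i : ℕ => (j, i)) fun a b h => by simpa using h
  have hind' : iIndepFun (fun i ω => quadError F τ N j i (γ j i ω) c) P :=
    hind.comp (fun i r => quadError F τ N j i r c) fun i => by
      simp only [quadError_apply hF hB]
      fun_prop
  have h := HasSubgaussianMGF.sum_of_iIndepFun hind' (s := Finset.range k)
    (c := fun _ => ‖τ / N * B‖₊ ^ 2) fun i _ => by
      simp only [quadError_apply hF hB]
      exact hasSubgaussianMGF_randomized_rectangle (hγ_meas j i) (hγ_unif j i) hFc hBc _ _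
  simpa using h

/-- One integrable random variable controls, exponentially, all the accumulated quadrature
errors. -/
theorem exists_integrable_sqrt_mul_norm_sum_quadError_le (hγ_meas : ∀ j k, Measurable (γ j k))
    (hγ_indep : iIndepFun (fun (jk : ℕ × ℕ) => γ jk.1 jk.2) P)
    (hγ_unif : ∀ j k, pdf.IsUniform (γ j k) (Icc 0 1) P volume)
    (hF : Measurable F) (hB : ∀ t, ‖F t‖ ≤ B) (n : ℕ) :
    ∃ W : Ω → ℝ, Measurable W ∧ (∀ ω, 0 ≤ W ω) ∧ Integrable W P ∧
      ∀ᵐ ω ∂P, ∀ N : ℕ, N ≠ 0 → ∀ j ≤ n, ∀ k ≤ N,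
        √N * ‖∑ i ∈ Finset.range k, quadError F τ N j i (γ j i ω)‖ ≤
          d * (3 * Real.log N + Real.log (1 + W ω)) := by
  set S : ℕ → ℕ → ℕ → Fin d → Ω → ℝ := fun N j k c ω =>
    ∑ i ∈ Finset.range k, quadError F τ N j i (γ j i ω) c with hS
  have hsub : ∀ N j k c, HasSubgaussianMGF (S N j k c) (k * ‖τ / N * B‖₊ ^ 2) P :=
    hasSubgaussianMGF_sum_quadError hγ_meas hγ_indep hγ_unif hF hB
  have hSm : ∀ N j k c, Measurable (S N j k c) := fun N j k c => by
    simp only [hS, quadError_apply hF hB]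
    fun_prop
  -- At `t = ±√N` the exponent is at most `N * (τ * B / N) ^ 2 * N / 2`, which does not depend on
  -- `N`.
  have hmgf : ∀ (N j k : ℕ) c (t : ℝ), N ≠ 0 → k ≤ N → t ^ 2 = N →
      ∫ ω, Real.exp (t * S N j k c ω) ∂P ≤ Real.exp ((τ * B) ^ 2 / 2) := by
    intro N j k c t hN hk ht
    refine ((hsub N j k c).mgf_le t).trans (Real.exp_le_exp.2 ?_)
    have hN' : (0 : ℝ) < N := by positivity
    have hk' : (k : ℝ) ≤ N := by exact_mod_cast hk
    push_cast
    rw [ht, Real.norm_eq_abs, sq_abs]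
    calc (k : ℝ) * (τ / N * B) ^ 2 * N / 2 ≤ N * (τ / N * B) ^ 2 * N / 2 := by gcongr
      _ = _ := by field_simp
  set e : ℕ → ℕ × ℕ × Fin d → Ω → ℝ := fun N p ω =>
    Real.exp (√N * S N p.1 p.2.1 p.2.2 ω) + Real.exp (-√N * S N p.1 p.2.1 p.2.2 ω) with he
  set s : ℕ → Finset (ℕ × ℕ × Fin d) := fun N =>
    Finset.range (n + 1) ×ˢ Finset.range (N + 1) ×ˢ Finset.univ with hs
  have hexp : ∀ N j k c (t : ℝ), Integrable (fun ω => Real.exp (t * S N j k c ω)) P :=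
    fun N j k c t => (hsub N j k c).integrable_exp_mul t
  have hei : ∀ N p, Integrable (e N p) P := fun N p =>
    (hexp N _ _ _ _).add (hexp N _ _ _ _)
  have hem : ∀ N p, Measurable (e N p) := fun N p =>
    ((hSm _ _ _ _).const_mul _).exp.add ((hSm _ _ _ _).const_mul _).exp
  have he0 : ∀ N p ω, 0 ≤ e N p ω := fun N p ω =>
    add_nonneg (Real.exp_nonneg _) (Real.exp_nonneg _)
  have heint : ∀ N, N ≠ 0 → ∀ p ∈ s N, ∫ ω, e N p ω ∂P ≤ 2 * Real.exp ((τ * B) ^ 2 / 2) := by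
    intro N hN p hp
    have hk : p.2.1 ≤ N := by
      simp only [hs, Finset.mem_product, Finset.mem_range] at hp
      omega
    simp only [he]
    rw [integral_add (hexp _ _ _ _ _) (hexp _ _ _ _ _), two_mul]
    exact add_le_add (hmgf N _ _ _ _ hN hk (by simp)) (hmgf N _ _ _ _ hN hk (by simp))
  obtain ⟨W, hWm, hW0, hWi, hW⟩ := exists_integrable_forall_le_pow_three_mul (P := P)
    (w := fun N ω => ∑ p ∈ s N, e N p ω)
    -- There are `(n + 1) * (N + 1) * d` index triples, and `N + 1 ≤ 2 * N`.
    (A := (n + 1) * (2 * (d * (2 * Real.exp ((τ * B) ^ 2 / 2)))))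
    (fun N => Finset.measurable_sum _ fun p _ => hem N p)
    (fun N ω => Finset.sum_nonneg fun p _ => he0 N p ω)
    (fun N => integrable_finsetSum _ fun p _ => hei N p) (by
      intro N hN
      have h1 : (1 : ℝ) ≤ N := by exact_mod_cast Nat.one_le_iff_ne_zero.2 hN
      rw [integral_finsetSum _ fun p _ => hei N p]
      calc _ ≤ ∑ p ∈ s N, 2 * Real.exp ((τ * B) ^ 2 / 2) :=
            Finset.sum_le_sum (heint N hN)
        _ = (n + 1) * ((N + 1) * (d * (2 * Real.exp ((τ * B) ^ 2 / 2)))) := by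
            rw [Finset.sum_const, nsmul_eq_mul]
            simp only [hs, Finset.card_product, Finset.card_range, Finset.card_univ,
              Fintype.card_fin]
            push_cast
            ring
        _ ≤ (n + 1) * ((2 * N) * (d * (2 * Real.exp ((τ * B) ^ 2 / 2)))) := by
            gcongr
            linarith
        _ = _ := by ring)
  refine ⟨W, hWm, hW0, hWi, ?_⟩
  filter_upwards [hW] with ω hω N hN j hj k hk
  have hN' : (0 : ℝ) < N := by positivity
  have hcoord : ∀ c, √N * |S N j k c ω| ≤ 3 * Real.log N + Real.log (1 + W ω) := by
    intro c
    have h1 : Real.exp (√N * |S N j k c ω|) ≤ e N (j, k, c) ω := by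
      simp only [he]
      rcases abs_cases (S N j k c ω) with ⟨h, _⟩ | ⟨h, _⟩ <;> rw [h]
      · linarith [Real.exp_pos (-√N * S N j k c ω)]
      · rw [mul_neg, ← neg_mul]
        linarith [Real.exp_pos (√N * S N j k c ω)]
    have hmem : (j, k, c) ∈ s N := by
      simp only [hs, Finset.mem_product, Finset.mem_range, Finset.mem_univ, and_true]
      omega
    have h2 : e N (j, k, c) ω ≤ ∑ p ∈ s N, e N p ω :=
      Finset.single_le_sum (f := fun p => e N p ω) (fun p _ => he0 N p ω) hmem
    have h5 : Real.exp (√N * |S N j k c ω|) ≤ (N : ℝ) ^ 3 * (1 + W ω) := by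
      refine h1.trans (h2.trans ((hω N hN).trans ?_))
      gcongr
      linarith
    have hWpos : 0 < 1 + W ω := by linarith [hW0 ω]
    have h6 := (Real.le_log_iff_exp_le (by positivity)).2 h5
    rwa [Real.log_mul (by positivity) hWpos.ne', Real.log_pow] at h6
  calc _ ≤ √N * ∑ c, |S N j k c ω| := by
        gcongr
        refine (EuclideanSpace.norm_le_sum_abs _).trans (le_of_eq ?_)
        refine Finset.sum_congr rfl fun c _ => ?_
        simp [hS]
    _ = ∑ c, √N * |S N j k c ω| := Finset.mul_sum _ _ _
    _ ≤ ∑ _c : Fin d, (3 * Real.log N + Real.log (1 + W ω)) :=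
        Finset.sum_le_sum fun c _ => hcoord c
    _ = _ := by simp [mul_add]

end QuadError

/-! ### Return to the original right-hand side and conclusion -/

/-- The node has a law absolutely continuous with respect to Lebesgue measure; `h ≠ 0` keeps it from
being deterministic. -/
theorem ae_comp_affine_of_isUniform {Ω : Type*} [MeasurableSpace Ω] {P : Measure Ω} {U : Ω → ℝ}
    (hm : Measurable U) (hU : pdf.IsUniform U (Icc 0 1) P volume) {p : ℝ → Prop}
    (hp : ∀ᵐ t ∂volume, p t) (a : ℝ) {h : ℝ} (hh : h ≠ 0) : ∀ᵐ ω ∂P, p (a + h * U ω) := by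
  have h1 : Measure.QuasiMeasurePreserving U P volume := ⟨hm, hU.absolutelyContinuous⟩
  have h2 : Measure.QuasiMeasurePreserving (fun x : ℝ => h * x) volume volume := by
    refine ⟨by fun_prop, ?_⟩
    rw [Real.map_volume_mul_left hh]
    exact Measure.smul_absolutelyContinuous
  have h3 := (measurePreserving_add_left (volume : Measure ℝ) a).quasiMeasurePreserving
  exact (h3.comp (h2.comp h1)).ae hp

theorem ae_mem_Icc_of_isUniform {Ω : Type*} [MeasurableSpace Ω] {P : Measure Ω} {U : Ω → ℝ}
    (hm : Measurable U) (hU : pdf.IsUniform U (Icc 0 1) P volume) : ∀ᵐ ω ∂P, U ω ∈ Icc (0 : ℝ) 1 := by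
  refine ae_of_ae_map hm.aemeasurable ?_
  rw [hU.map_eq_restrict_Icc]
  exact ae_restrict_mem measurableSet_Icc

theorem eulerRow_congr {d : ℕ} {f g : ℝ → Vec d → Vec d → Vec d} {τ : ℝ} {N j : ℕ} {r : ℕ → ℝ}
    {p q : ℕ → Vec d} (hpq : ∀ k ≤ N, p k = q k)
    (hfg : ∀ k < N, ∀ x z, g (gridPoint τ N j k + (τ / N) * r k) x z =
      f (gridPoint τ N j k + (τ / N) * r k) x z) (k : ℕ) (hk : k ≤ N) :
    eulerRow g τ N j r p k = eulerRow f τ N j r q k := by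
  induction k with
  | zero => exact hpq N le_rfl
  | succ k ih =>
    simp only [eulerRow]
    rw [ih (by omega), hpq k (by omega), hfg k (by omega)]

theorem randomizedEuler_congr {d : ℕ} {f g : ℝ → Vec d → Vec d → Vec d} {τ : ℝ} {x₀ : Vec d}
    {n N : ℕ} {r : ℕ → ℕ → ℝ}
    (hfg : ∀ j ≤ n, ∀ k < N, ∀ x z, g (gridPoint τ N j k + (τ / N) * r j k) x z =
      f (gridPoint τ N j k + (τ / N) * r j k) x z) (j : ℕ) (hj : j ≤ n) (k : ℕ) (hk : k ≤ N) :
    randomizedEuler g τ x₀ N r j k = randomizedEuler f τ x₀ N r j k := by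
  induction j generalizing k with
  | zero => exact eulerRow_congr (fun _ _ => rfl) (hfg 0 hj) k hk
  | succ j ih => exact eulerRow_congr (fun k hk => ih (by omega) k hk) (hfg _ hj) k hk

theorem IsDelaySolution.congr {d : ℕ} {f g : ℝ → Vec d → Vec d → Vec d} {τ T : ℝ} {x₀ : Vec d}
    {x : ℝ → Vec d} (hx : IsDelaySolution τ T x₀ f x)
    (hfg : ∀ᵐ t ∂(volume.restrict (Icc 0 T)), ∀ x z, g t x z = f t x z) :
    IsDelaySolution τ T x₀ g x := by
  refine ⟨hx.initial, hx.absolutelyContinuous, ?_⟩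
  filter_upwards [hx.hasDerivAt, hfg] with t h1 h2
  rwa [h2]

theorem proposition3 {d : ℕ} (n : ℕ) (τ : ℝ) (hτ : 0 < τ) (x₀ : Vec d)
    (f : ℝ → Vec d → Vec d → Vec d)
    (hf : IsAdmissibleRHS (((n : ℝ) + 1) * τ) ∞ 1 f)
    {Ω : Type*} [MeasurableSpace Ω] (P : Measure Ω) [IsProbabilityMeasure P]
    (γ : ℕ → ℕ → Ω → ℝ)
    (hγ_meas : ∀ j k, Measurable (γ j k))
    (hγ_indep : iIndepFun (fun (jk : ℕ × ℕ) => γ jk.1 jk.2) P)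
    (hγ_unif : ∀ j k, pdf.IsUniform (γ j k) (Icc 0 1) P volume) :
    (∃ x : ℝ → Vec d, IsDelaySolution τ (((n : ℝ) + 1) * τ) x₀ f x) ∧
    ∀ x : ℝ → Vec d, IsDelaySolution τ (((n : ℝ) + 1) * τ) x₀ f x →
      ∀ ε ∈ Ioo (0 : ℝ) (1 / 2), ∃ η : Ω → ℝ, Measurable η ∧
        (∀ q : ℝ, 2 ≤ q → MemLp η (ENNReal.ofReal q) P) ∧
        ∀ᵐ ω ∂P, ∀ N : ℕ, ⌈τ⌉₊ ≤ N →
          maxGridError f τ x₀ n N x (fun j k => γ j k ω) ≤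
            η ω * (N : ℝ) ^ (-(1 / 2 : ℝ) + ε) := by
  have hT : 0 ≤ ((n : ℝ) + 1) * τ := by positivity
  obtain ⟨C, g, hg, hgf⟩ := hf.exists_uniformlyLipschitz hT
  constructor
  · obtain ⟨x, hx⟩ := hg.exists_isDelaySolution hT hτ.le x₀
    exact ⟨x, hx.congr (hgf.mono fun t h x z => (h x z).symm)⟩
  intro x hx ε hε
  obtain ⟨X, B, hXx, hFm, hFB, hXint, hLip⟩ := (hx.congr hgf).exists_extension hg hT hτ.le
  have hX₀ : ∀ t ∈ Icc (-τ) 0, X t = x₀ := fun t ht => by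
    rw [hXx t ⟨ht.1, ht.2.trans hT⟩, hx.initial t ht]
  obtain ⟨c, hc, herr⟩ := exists_norm_sub_randomizedEuler_le hg hτ.le (n := n) hX₀ hLip hXint
  obtain ⟨W, hWm, hW0, hWi, hW⟩ := exists_integrable_sqrt_mul_norm_sum_quadError_le (τ := τ)
    hγ_meas hγ_indep hγ_unif hFm hFB n
  -- `3 / ε` comes from `log N ≤ N ^ ε / ε`, and `τ` from `τ / N ≤ τ / √N`.
  refine ⟨fun ω => c * (d * (3 / ε) + τ + d * Real.log (1 + W ω)), by fun_prop, ?_, ?_⟩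
  · intro q hq
    have h1 : MemLp (fun ω => d * Real.log (1 + W ω)) (ENNReal.ofReal q) P :=
      (memLp_log_one_add hWm hW0 hWi (by linarith)).const_mul (d : ℝ)
    have h2 : MemLp (fun _ : Ω => d * (3 / ε) + τ) (ENNReal.ofReal q) P := memLp_const _
    exact (h2.add h1).const_mul c
  have hγ01 : ∀ᵐ ω ∂P, ∀ j k, γ j k ω ∈ Icc (0 : ℝ) 1 :=
    ae_all_iff.2 fun j => ae_all_iff.2 fun k => ae_mem_Icc_of_isUniform (hγ_meas j k) (hγ_unif j k)
  rw [ae_restrict_iff' measurableSet_Icc] at hgf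
  have hnodes : ∀ᵐ ω ∂P, ∀ N : ℕ, N ≠ 0 → ∀ j k,
      gridPoint τ N j k + (τ / N) * γ j k ω ∈ Icc 0 (((n : ℝ) + 1) * τ) →
      ∀ x z, g (gridPoint τ N j k + (τ / N) * γ j k ω) x z =
        f (gridPoint τ N j k + (τ / N) * γ j k ω) x z := by
    refine ae_all_iff.2 fun N => ?_
    rcases eq_or_ne N 0 with rfl | hN
    · simp
    · have hh : τ / N ≠ 0 := by positivity
      filter_upwards [ae_all_iff.2 fun j => ae_all_iff.2 fun k =>
        ae_comp_affine_of_isUniform (hγ_meas j k) (hγ_unif j k) hgf (gridPoint τ N j k) hh]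
        with ω hω _ j k using hω j k
  filter_upwards [hW, hγ01, hnodes] with ω hWω hγω hnω N hNτ
  have hN : N ≠ 0 := by
    have := Nat.ceil_pos.2 hτ
    omega
  have hN1 : (1 : ℝ) ≤ N := by exact_mod_cast Nat.one_le_iff_ne_zero.2 hN
  have hN0 : (0 : ℝ) < N := by linarith
  have hh : 0 ≤ τ / N := by positivity
  have hcongr := randomizedEuler_congr (x₀ := x₀) (r := fun j k => γ j k ω) (n := n) (N := N)
    -- The node lies between two consecutive grid points of `[0, T]`.
    fun j hj k hk => hnω N hN j k (by
      have h1 := gridPoint_mem_Icc (n := n) hτ.le hj hk.le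
      have h2 := gridPoint_mem_Icc (n := n) hτ.le hj (Nat.succ_le_of_lt hk)
      rw [Nat.succ_eq_add_one, gridPoint_succ] at h2
      have h3 := hγω j k
      exact ⟨by nlinarith [h1.1, h3.1], by nlinarith [h2.2, h3.2]⟩)
  have hsqrt : 0 < √(N : ℝ) := Real.sqrt_pos.2 hN0
  have hbound := herr N (fun j k => γ j k ω)
    (d * (3 * Real.log N + Real.log (1 + W ω)) / √N) hN (fun j _ k _ => hγω j k)
    fun j hj k hk => by
      rw [le_div_iff₀ hsqrt, mul_comm]
      exact hWω N hN j hj k hk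
  have hmain : c * (d * (3 * Real.log N + Real.log (1 + W ω)) / √N + τ / N) ≤
      c * (d * (3 / ε) + τ + d * Real.log (1 + W ω)) * (N : ℝ) ^ (-(1 / 2 : ℝ) + ε) := by
    have hNε : 1 ≤ (N : ℝ) ^ ε := Real.one_le_rpow hN1 hε.1.le
    have hlog : Real.log N ≤ (N : ℝ) ^ ε / ε := Real.log_le_rpow_div hN0.le hε.1
    have hl0 : 0 ≤ Real.log (1 + W ω) := Real.log_nonneg (by linarith [hW0 ω])
    have hpow : (N : ℝ) ^ (-(1 / 2 : ℝ) + ε) = (N : ℝ) ^ ε / √N := by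
      rw [Real.rpow_add hN0, Real.rpow_neg hN0.le, ← Real.sqrt_eq_rpow]
      ring
    have hτN : τ / N ≤ τ / √N := by
      gcongr
      exact Real.sqrt_le_self_iff.2 (Or.inr hN1)
    rw [hpow, mul_assoc]
    refine mul_le_mul_of_nonneg_left ?_ hc
    calc _ ≤ d * (3 * Real.log N + Real.log (1 + W ω)) / √N + τ / √N := by gcongr
      _ = (d * (3 * Real.log N + Real.log (1 + W ω) * 1) + τ * 1) / √N := by ring
      _ ≤ (d * (3 * ((N : ℝ) ^ ε / ε) + Real.log (1 + W ω) * (N : ℝ) ^ ε) +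
            τ * (N : ℝ) ^ ε) / √N := by gcongr
      _ = _ := by ring
  refine Finset.sup'_le _ _ fun j hj => Finset.sup'_le _ _ fun k hk => ?_
  have hj' : j ≤ n := by have := Finset.mem_range.1 hj; omega
  have hk' : k ≤ N := by have := Finset.mem_range.1 hk; omega
  have hgrid := gridPoint_mem_Icc (n := n) hτ.le hj' hk'
  rw [← hcongr j hj' k hk', ← hXx _ ⟨by linarith [hgrid.1], hgrid.2⟩]
  exact (hbound j hj' k hk').trans hmain
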